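/- Let $m\ge 1$, $N\ge 0$, and let $S(z)=\sum_{n=-N}^{N}C_nz^n$, $C_n\in\mathbb{C}^{m\times m}$, $C_N\neq 0$, be a Laurent polynomial matrix function of degree $N$ which is positive definite for almost every $z$ on the unit circle $\mathbb{T}=\{z\in\mathbb{C}:|z|=1\}$. For a scalar or matrix polynomial $F$ write $\widetilde F(z)=F(1/\overline z)^*$, $z\in\mathbb{C}\setminus\{0\}$, where $*$ denotes the conjugate transpose (the complex conjugate for scalars). Let $p$ be any scalar polynomial spectral factor of $\det S$, optimal or not, that is, any polynomial $p\in\mathbb{C}[z]$ of degree at most $mN$ such that $$p(z)\,\widetilde p(z)=\det S(z),\qquad z\in\mathbb{C}\setminus\{0\}.$$ (No condition is imposed on the location of the zeros of $p$; the degree bound holds automatically if $p(0)\ne 0$, or if the degree of $p$ does not exceed that of the Laurent polynomial $\det S$.) Then there exists a polynomial matrix function of the same degree $N$, $$P(z)=\sum_{n=0}^{N}B_nz^n,\qquad B_n\in\mathbb{C}^{m\times m},\quad B_N\ne 0,$$ such that $$P(z)\,\widetilde P(z)=S(z)\quad (z\in\mathbb{C}\setminus\{0\})\qquad\text{and}\qquad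 \det P(z)=p(z)\quad (z\in\mathbb{C}).$$ -/

import Mathlib

open scoped ComplexOrder

namespace SpectralFactorization

/-- The Laurent polynomial matrix function `z ↦ ∑_{n=-N}^{N} C_n z^n` (used for `z ≠ 0`). -/
noncomputable def laurentMatrix {m : ℕ} (N : ℕ) (C : ℤ → Matrix (Fin m) (Fin m) ℂ) (z : ℂ) :
    Matrix (Fin m) (Fin m) ℂ :=
  ∑ n ∈ Finset.Icc (-(N : ℤ)) (N : ℤ), z ^ n • C n

/-- The polynomial matrix function `z ↦ ∑_{n=0}^{N} B_n z^n`. -/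
noncomputable def polyMatrix {m : ℕ} (N : ℕ) (B : ℕ → Matrix (Fin m) (Fin m) ℂ) (z : ℂ) :
    Matrix (Fin m) (Fin m) ℂ :=
  ∑ n ∈ Finset.range (N + 1), z ^ n • B n

/-- The adjoint `F̃(z) = F(1 / z̄)ᴴ` of a matrix function (used for `z ≠ 0`). -/
noncomputable def matrixAdjoint {m : ℕ} (F : ℂ → Matrix (Fin m) (Fin m) ℂ) (z : ℂ) :
    Matrix (Fin m) (Fin m) ℂ :=
  (F (1 / starRingEnd ℂ z)).conjTranspose

/-- The adjoint of a scalar function, `f̃(z)` being the conjugate of `f(1 / z̄)`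
(used for `z ≠ 0`). -/
noncomputable def scalarAdjoint (f : ℂ → ℂ) (z : ℂ) : ℂ :=
  starRingEnd ℂ (f (1 / starRingEnd ℂ z))

/-- The matrix function `F` is positive definite almost everywhere on the unit circle. -/
def PosDefAEOnCircle {m : ℕ} (F : ℂ → Matrix (Fin m) (Fin m) ℂ) : Prop :=
  ∀ᵐ θ : ℝ, θ ∈ Set.Ico 0 (2 * Real.pi) → (F (Complex.exp (θ * Complex.I))).PosDef

end SpectralFactorization

/-! Everything takes place in matrices over `ℂ[T;T⁻¹]`, with `star` playing the role of the tilde; a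
congruence `E S Ẽ` by a polynomial matrix with determinant 1 changes neither the problem nor the
determinant.

Suppose first that the prescribed factor `q` has `q(0) ≠ 0`. At a zero `a` of `q` the matrix `S(a)`
is singular, and after a constant congruence one row vanishes at `a` and, by symmetry, one column at
`1/ā`. Their common diagonal entry vanishes at both points, and to second order if they coincide, by
positivity on the circle. Hence a factor `z - a` splits off on the left and its adjoint on the right
(`exists_root_removal`). No choice between `a` and `1/ā` is forced, which is why any spectral factor
of the determinant can be prescribed. When the zeros are exhausted, `det S` is constant; column
reduction by congruences (`exists_index_reduction`) makes `S` polynomial, hence constant by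
symmetry, and a positive definite constant matrix factors directly.

The bound on the degree of `P` comes from `P̃ = P⁻¹ S`, as `det P(0) ≠ 0`
(`natDegree_le_of_factor`). Zeros of `p` at the origin are invisible in `p p̃`; they are restored by
multiplying `P` on the right by degree-one factors that are unitary on the circle, without raising
its degree (`exists_factor_det_eq_X_mul`). -/

namespace SpectralFactorization

open scoped LaurentPolynomial
open LaurentPolynomial Polynomial Matrix Filter Topology

/-! ### The involution on Laurent polynomials -/

/-- The ring endomorphism of `ℂ[T;T⁻¹]` conjugating coefficients and sending `T` to `T⁻¹`. -/
noncomputable def conjInvert : ℂ[T;T⁻¹] →+* ℂ[T;T⁻¹] :=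
  LaurentPolynomial.eval₂ (LaurentPolynomial.C.comp (starRingEnd ℂ))
    ⟨T (-1), T 1, by rw [← T_add]; simp, by rw [← T_add]; simp⟩

lemma conjInvert_C (a : ℂ) : conjInvert (LaurentPolynomial.C a) =
    LaurentPolynomial.C (starRingEnd ℂ a) := by
  simp [conjInvert]

lemma conjInvert_T (n : ℤ) : conjInvert (T n) = T (-n) := by
  obtain ⟨k, rfl | rfl⟩ := n.eq_nat_or_neg
  · rw [conjInvert, eval₂_T_n]
    simp [T_pow]
  · rw [conjInvert, eval₂_T_neg_n]
    simp [T_pow]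

noncomputable instance : StarRing ℂ[T;T⁻¹] where
  star := conjInvert
  star_involutive f := by
    induction f using LaurentPolynomial.induction_on' with
    | add p q hp hq => rw [map_add, map_add, hp, hq]
    | C_mul_T n a => simp only [map_mul, conjInvert_C, conjInvert_T]; simp
  star_mul f g := by rw [map_mul, mul_comm]
  star_add f g := map_add _ _ _

@[simp] lemma star_laurent_C (a : ℂ) : star (LaurentPolynomial.C a) =
    LaurentPolynomial.C (starRingEnd ℂ a) := conjInvert_C a

@[simp] lemma star_laurent_T (n : ℤ) : star (T n : ℂ[T;T⁻¹]) = T (-n) := conjInvert_T n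

lemma coeff_star (f : ℂ[T;T⁻¹]) (n : ℤ) :
    (star f).coeff n = starRingEnd ℂ (f.coeff (-n)) := by
  induction f using LaurentPolynomial.induction_on' with
  | add p q hp hq => simp [hp, hq]
  | C_mul_T k a =>
    rw [star_mul', star_laurent_C, star_laurent_T, ← single_eq_C_mul_T, ← single_eq_C_mul_T]
    simp only [AddMonoidAlgebra.coeff_single, Finsupp.single_apply, neg_eq_iff_eq_neg]
    split_ifs <;> simp_all

/-! ### Evaluation of Laurent polynomials -/

/-- Evaluation of Laurent polynomials at a nonzero complex number. -/
noncomputable def ev (u : ℂˣ) : ℂ[T;T⁻¹] →+* ℂ :=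
  LaurentPolynomial.eval₂ (RingHom.id ℂ) u

@[simp] lemma ev_C (u : ℂˣ) (a : ℂ) : ev u (LaurentPolynomial.C a) = a := by simp [ev]

@[simp] lemma ev_T (u : ℂˣ) (n : ℤ) : ev u (T n) = (u : ℂ) ^ n := by simp [ev]

@[simp] lemma ev_toLaurent (u : ℂˣ) (p : ℂ[X]) : ev u (toLaurent p) = p.eval (u : ℂ) := by
  simp [ev, Polynomial.eval₂_id]

lemma ev_star (u : ℂˣ) (f : ℂ[T;T⁻¹]) : ev u (star f) = starRingEnd ℂ (ev (star u)⁻¹ f) := by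
  induction f using LaurentPolynomial.induction_on' with
  | add p q hp hq => simp [hp, hq]
  | C_mul_T k a => simp [star_mul']

lemma star_inv_eq_self {u : ℂˣ} (hu : ‖(u : ℂ)‖ = 1) : (star u)⁻¹ = u := by
  ext
  simp only [Units.val_inv_eq_inv_val, Units.coe_star]
  rw [inv_eq_iff_eq_inv, Complex.inv_def]
  simp [Complex.normSq_eq_norm_sq, hu]

lemma ev_star_of_norm_eq_one {u : ℂˣ} (hu : ‖(u : ℂ)‖ = 1) (f : ℂ[T;T⁻¹]) :
    ev u (star f) = starRingEnd ℂ (ev u f) := by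
  rw [ev_star, star_inv_eq_self hu]

lemma laurent_eq_zero_of_infinite {f : ℂ[T;T⁻¹]} {s : Set ℂ} (hs : s.Infinite)
    (h : ∀ u : ℂˣ, (u : ℂ) ∈ s → ev u f = 0) : f = 0 := by
  obtain ⟨n, p, hp⟩ := f.exists_T_pow
  have hp0 : p = 0 := by
    refine Polynomial.eq_zero_of_infinite_isRoot p ((hs.sdiff (Set.finite_singleton 0)).mono ?_)
    rintro z ⟨hz, hz0⟩
    have := congrArg (ev (Units.mk0 z hz0)) hp
    rw [map_mul, h _ hz, zero_mul, ev_toLaurent] at this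
    exact this
  rw [hp0, map_zero] at hp
  exact ((isUnit_T (R := ℂ) n).mul_left_eq_zero).mp hp.symm

lemma exists_eq_sub_mul {f : ℂ[T;T⁻¹]} {a : ℂˣ} (h : ev a f = 0) :
    ∃ g, f = toLaurent (X - Polynomial.C (a : ℂ)) * g := by
  obtain ⟨n, p, hp⟩ := f.exists_T_pow
  have hr : p.IsRoot (a : ℂ) := by
    have := congrArg (ev a) hp
    rwa [map_mul, h, zero_mul, ev_toLaurent] at this
  obtain ⟨q, rfl⟩ := Polynomial.dvd_iff_isRoot.mpr hr
  refine ⟨toLaurent q * T (-n), ?_⟩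
  rw [← mul_assoc, ← map_mul, hp, mul_T_assoc]
  simp

/-- A polynomial `q` with `q(0) ≠ 0` is coprime to `X`, so multiplying by it cannot clear a pole at
the origin. -/
lemma mem_range_of_toLaurent_mul {q r : ℂ[X]} (hq : q.eval 0 ≠ 0) {f : ℂ[T;T⁻¹]}
    (h : toLaurent q * f = toLaurent r) : ∃ s : ℂ[X], f = toLaurent s := by
  obtain ⟨n, p, hp⟩ := f.exists_T_pow
  have hdvd : X ^ n ∣ q * p := by
    refine ⟨r, toLaurent_injective ?_⟩
    rw [map_mul, hp, ← mul_assoc, h, map_mul, toLaurent_X_pow, mul_comm]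
  have hcop : IsCoprime (X ^ n : ℂ[X]) q := by
    refine IsCoprime.pow_left (((Polynomial.irreducible_X).coprime_iff_not_dvd).mpr ?_)
    rwa [Polynomial.X_dvd_iff, Polynomial.coeff_zero_eq_eval_zero]
  obtain ⟨s, rfl⟩ := hcop.dvd_of_dvd_mul_left hdvd
  refine ⟨s, ?_⟩
  rw [map_mul, toLaurent_X_pow, mul_comm] at hp
  exact ((isUnit_T (R := ℂ) n).mul_left_inj.mp hp).symm

lemma toLaurent_coeff_of_neg (p : ℂ[X]) {n : ℤ} (hn : n < 0) : (toLaurent p).coeff n = 0 := by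
  by_contra h
  have := Finsupp.mem_support_iff.mpr h
  rw [support_coeff_toLaurent] at this
  simp at this
  omega

lemma toLaurent_coeff_natCast (p : ℂ[X]) (n : ℕ) : (toLaurent p).coeff (n : ℤ) = p.coeff n := by
  rw [coeff_toLaurent]
  exact Finsupp.mapDomain_apply Nat.cast_injective _ _

section

/-! ### Positivity on the unit circle -/

variable {n : Type*}

lemma ev_matrix_conjTranspose {u : ℂˣ} (hu : ‖(u : ℂ)‖ = 1) (S : Matrix n n ℂ[T;T⁻¹]) :
    Sᴴ.map (ev u) = (S.map (ev u))ᴴ := by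
  ext i j
  simp [ev_star_of_norm_eq_one hu]

/-- The Laurent polynomial matrix `S` is positive definite at all but finitely many points of the
unit circle. -/
def PosOnCircle (S : Matrix n n ℂ[T;T⁻¹]) : Prop :=
  ∀ᶠ u : ℂˣ in cofinite, ‖(u : ℂ)‖ = 1 → (S.map (ev u)).PosDef

lemma infinite_circle : {u : ℂˣ | ‖(u : ℂ)‖ = 1}.Infinite := by
  have h : (Set.univ : Set Circle).Infinite := by
    have hs : (Metric.sphere (0 : ℂ) 1).Infinite := by
      refine IsPreconnected.infinite_of_nontrivial ?_ ⟨1, by simp, -1, by simp, by norm_num⟩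
      exact isPreconnected_sphere (by simp [Complex.rank_real_complex]) _ _
    exact Set.infinite_univ_iff.mpr (Set.infinite_coe_iff.mpr hs)
  refine (h.image (f := Circle.toUnits) ?_).mono ?_
  · intro x _ y _ hxy
    have := congrArg (Units.val) hxy
    exact Circle.ext (by simpa using this)
  · rintro _ ⟨x, -, rfl⟩
    exact Circle.norm_coe x

lemma PosOnCircle.exists_posDef {S : Matrix n n ℂ[T;T⁻¹]} (hS : PosOnCircle S) :
    ∃ u : ℂˣ, ‖(u : ℂ)‖ = 1 ∧ (S.map (ev u)).PosDef := by
  have := (frequently_cofinite_iff_infinite.mpr infinite_circle).and_eventually hS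
  obtain ⟨u, hu, h⟩ := this.exists
  exact ⟨u, hu, h hu⟩

lemma PosOnCircle.diag_ne_zero {S : Matrix n n ℂ[T;T⁻¹]} (hS : PosOnCircle S) (i : n) :
    S i i ≠ 0 := by
  intro h
  obtain ⟨u, -, hu⟩ := hS.exists_posDef
  have := hu.diag_pos (i := i)
  simp [h] at this

variable [Fintype n]

lemma ev_matrix_congr {u : ℂˣ} (hu : ‖(u : ℂ)‖ = 1) (E S : Matrix n n ℂ[T;T⁻¹]) :
    (E * S * Eᴴ).map (ev u) = E.map (ev u) * S.map (ev u) * star (E.map (ev u)) := by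
  rw [Matrix.map_mul, Matrix.map_mul, ev_matrix_conjTranspose hu, star_eq_conjTranspose]

variable [DecidableEq n]

lemma PosOnCircle.congr {S : Matrix n n ℂ[T;T⁻¹]} (hS : PosOnCircle S)
    {E : Matrix n n ℂ[T;T⁻¹]} (hE : E.det = 1) : PosOnCircle (E * S * Eᴴ) := by
  filter_upwards [hS] with u h hu
  rw [ev_matrix_congr hu, IsUnit.posDef_star_right_conjugate_iff]
  · exact h hu
  · rw [isUnit_iff_isUnit_det, ← RingHom.mapMatrix_apply, ← RingHom.map_det, hE, map_one]
    exact isUnit_one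

/-- Nothing is asked of `E`: where the congruent matrix is positive definite its determinant is
nonzero, so `E` is invertible there. -/
lemma PosOnCircle.of_congr {S E : Matrix n n ℂ[T;T⁻¹]} (h : PosOnCircle (E * S * Eᴴ)) :
    PosOnCircle S := by
  filter_upwards [h] with u h hu
  have h1 := h hu
  rw [ev_matrix_congr hu] at h1
  have h2 : IsUnit (E.map (ev u)) := by
    have := h1.isUnit
    rw [isUnit_iff_isUnit_det] at this ⊢
    rw [det_mul, det_mul] at this
    exact isUnit_of_mul_isUnit_left (isUnit_of_mul_isUnit_left this)
  exact (IsUnit.posDef_star_right_conjugate_iff h2).mp h1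

/-! ### Zeros of Laurent polynomials that are nonnegative on the circle -/

lemma tendsto_mul_exp_cofinite (a : ℂˣ) :
    Tendsto (fun t : ℝ => a * Units.mk0 (Complex.exp (t * Complex.I)) (Complex.exp_ne_zero _))
      (𝓝[≠] 0) cofinite := by
  have hd : HasDerivAt (fun t : ℝ => (a : ℂ) * Complex.exp (t * Complex.I))
      (a * Complex.I) 0 := by
    have := (((Complex.ofRealCLM.hasDerivAt (x := 0)).mul_const Complex.I).cexp).const_mul (a : ℂ)
    simpa using this
  have h1 := hd.tendsto_nhdsNE (by simp)
  rw [← Function.Injective.comap_cofinite_eq Units.val_injective, tendsto_comap_iff]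
  exact (h1.mono_right (nhdsNE_le_cofinite _)).congr (fun t => by simp)

/-- A zero on the circle of a function nonnegative there is a minimum along the circle, so the
tangential derivative, which is `i a g(a)`, vanishes. -/
lemma ev_eq_zero_of_nonneg_on_circle {f g : ℂ[T;T⁻¹]} {a : ℂˣ} (ha : ‖(a : ℂ)‖ = 1)
    (hf : ∀ᶠ u : ℂˣ in cofinite, ‖(u : ℂ)‖ = 1 → 0 ≤ ev u f)
    (hfg : f = toLaurent (X - Polynomial.C (a : ℂ)) * g) : ev a g = 0 := by
  obtain ⟨n, p, hp⟩ := g.exists_T_pow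
  set G : ℂ → ℂ := fun z => p.eval z * (z ^ n)⁻¹ with hG
  have hev : ∀ u : ℂˣ, ev u g = G u := by
    intro u
    have := congrArg (ev u) hp
    rw [ev_toLaurent, map_mul, ev_T] at this
    simp only [hG, this, zpow_natCast]
    have hu : (u : ℂ) ^ n ≠ 0 := pow_ne_zero _ u.ne_zero
    field_simp
  set φ : ℝ → ℂ := fun t => (a * Complex.exp (t * Complex.I) - a) *
    G (a * Complex.exp (t * Complex.I)) with hφ
  have hd : HasDerivAt φ (a * Complex.I * G a) 0 := by
    have h1 : HasDerivAt (fun t : ℝ => (a : ℂ) * Complex.exp (t * Complex.I))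
        (a * Complex.I) 0 := by
      have := (((Complex.ofRealCLM.hasDerivAt (x := 0)).mul_const
        Complex.I).cexp).const_mul (a : ℂ)
      simpa using this
    have h2 : DifferentiableAt ℂ G a := by
      refine p.differentiableAt.mul ((differentiableAt_id.pow n).inv ?_)
      exact pow_ne_zero _ a.ne_zero
    have h3 : HasDerivAt (fun z : ℂ => (z - a) * G z) (G a) (a : ℂ) := by
      convert! ((hasDerivAt_id (a : ℂ)).sub_const (a : ℂ)).mul h2.hasDerivAt using 1
      simp
    have h4 : HasDerivAt (fun z : ℂ => (z - a) * G z) (G a)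
        ((fun t : ℝ => (a : ℂ) * Complex.exp (t * Complex.I)) 0) := by simpa using h3
    have := h4.comp (0 : ℝ) h1
    rw [mul_comm]
    exact this
  have hpos : ∀ᶠ t : ℝ in 𝓝 0, 0 ≤ φ t := by
    have := (tendsto_mul_exp_cofinite a).eventually hf
    rw [eventually_nhdsWithin_iff] at this
    filter_upwards [this] with t ht
    rcases eq_or_ne t 0 with rfl | h0
    · simp [hφ]
    · have := ht h0 (by simp [ha, Complex.norm_exp_ofReal_mul_I])
      rw [hfg, map_mul, ev_toLaurent, hev] at this
      simpa [hφ] using this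
  have hre : (a * Complex.I * G a : ℂ).re = 0 := by
    have h1 : HasDerivAt (fun t => (φ t).re) (a * Complex.I * G a : ℂ).re 0 :=
      Complex.reCLM.hasFDerivAt.comp_hasDerivAt (0 : ℝ) hd
    refine IsLocalMin.hasDerivAt_eq_zero ?_ h1
    filter_upwards [hpos] with t ht
    simpa [hφ] using (Complex.nonneg_iff.mp ht).1
  -- In the order on `ℂ`, `0 ≤ φ t` forces the imaginary part to vanish near `0`, so it too has a
  -- local minimum.
  have him : (a * Complex.I * G a : ℂ).im = 0 := by
    have h1 : HasDerivAt (fun t => (φ t).im) (a * Complex.I * G a : ℂ).im 0 :=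
      Complex.imCLM.hasFDerivAt.comp_hasDerivAt (0 : ℝ) hd
    refine IsLocalMin.hasDerivAt_eq_zero ?_ h1
    filter_upwards [hpos] with t ht
    simpa [hφ] using (Complex.nonneg_iff.mp ht).2.le
  have h0 : (a * Complex.I * G a : ℂ) = 0 := Complex.ext hre him
  rw [hev]
  simpa using h0

/-- By symmetry `f` vanishes at `b = 1/ā` too. If `b ≠ a` the second linear factor comes for free;
if `b = a` the point lies on the circle and positivity makes the zero double. -/
lemma exists_eq_mul_mul_star {f : ℂ[T;T⁻¹]} {a : ℂˣ} (hsf : star f = f)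
    (hf : ∀ᶠ u : ℂˣ in cofinite, ‖(u : ℂ)‖ = 1 → 0 ≤ ev u f) (h0 : ev a f = 0) :
    ∃ h, f = toLaurent (X - Polynomial.C (a : ℂ)) * h *
      star (toLaurent (X - Polynomial.C (a : ℂ))) := by
  obtain ⟨g, hg⟩ := exists_eq_sub_mul h0
  set b : ℂˣ := (star a)⁻¹ with hb
  have hgb : ev b g = 0 := by
    by_cases hab : b = a
    · have ha : ‖(a : ℂ)‖ = 1 := by
        have h1 := congrArg Units.val (inv_eq_iff_mul_eq_one.mp (hb.symm.trans hab))
        have h2 := congrArg norm h1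
        simp at h2
        nlinarith [norm_nonneg (a : ℂ)]
      rw [hab]
      exact ev_eq_zero_of_nonneg_on_circle ha hf hg
    · have h1 : ev b f = 0 := by
        rw [← hsf, ev_star]
        simp [hb, h0]
      rw [hg, map_mul, ev_toLaurent] at h1
      refine (mul_eq_zero.mp h1).resolve_left ?_
      simpa [sub_eq_zero, Units.val_inj] using hab
  obtain ⟨h, hh⟩ := exists_eq_sub_mul hgb
  refine ⟨LaurentPolynomial.C (-(b : ℂ)) * T 1 * h, ?_⟩
  have key : toLaurent (X - Polynomial.C (b : ℂ)) =
      LaurentPolynomial.C (-(b : ℂ)) * T 1 * star (toLaurent (X - Polynomial.C (a : ℂ))) := by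
    have hba : (b : ℂ) * starRingEnd ℂ (a : ℂ) = 1 := by simp [hb]
    have hT : (T 1 : ℂ[T;T⁻¹]) * T (-1) = 1 := by rw [← T_add]; simp
    have hC : LaurentPolynomial.C (b : ℂ) * LaurentPolynomial.C (starRingEnd ℂ (a : ℂ)) = 1 := by
      rw [← map_mul, hba, map_one]
    simp only [map_sub, toLaurent_X, toLaurent_C, star_sub, star_laurent_T, star_laurent_C,
      map_neg]
    linear_combination (-T 1) * hC + LaurentPolynomial.C (b : ℂ) * hT
  rw [hg, hh, key]
  ring

end

section

/-! ### Polynomial spectral factors -/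

variable {n : Type*} [Fintype n]

lemma isHermitian_congr {S : Matrix n n ℂ[T;T⁻¹]} (hS : S.IsHermitian)
    (E : Matrix n n ℂ[T;T⁻¹]) : (E * S * Eᴴ).IsHermitian :=
  isHermitian_mul_mul_conjTranspose E hS

variable [DecidableEq n]

lemma det_updateRow_one {R : Type*} [CommRing R] (i : n) (x : n → R) :
    ((1 : Matrix n n R).updateRow i x).det = x i := by
  rw [← cramer_transpose_apply, transpose_one, cramer_one]
  rfl

/-- `S = P P̃` for a polynomial matrix `P` with determinant `q`. -/
def HasFactor (S : Matrix n n ℂ[T;T⁻¹]) (q : ℂ[X]) : Prop :=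
  ∃ P : Matrix n n ℂ[X], P.map toLaurent * (P.map toLaurent)ᴴ = S ∧ P.det = q

lemma det_map_toLaurent (P : Matrix n n ℂ[X]) :
    (P.map toLaurent).det = toLaurent P.det := by
  rw [← RingHom.mapMatrix_apply, ← RingHom.map_det]

lemma HasFactor.mul_left {S : Matrix n n ℂ[T;T⁻¹]} {q : ℂ[X]} (h : HasFactor S q)
    (E : Matrix n n ℂ[X]) :
    HasFactor (E.map toLaurent * S * (E.map toLaurent)ᴴ) (E.det * q) := by
  obtain ⟨P, rfl, rfl⟩ := h
  refine ⟨E * P, ?_, det_mul _ _⟩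
  simp only [Matrix.map_mul, conjTranspose_mul, Matrix.mul_assoc]

lemma HasFactor.of_congr {S : Matrix n n ℂ[T;T⁻¹]} {q : ℂ[X]} {E : Matrix n n ℂ[X]}
    (hE : E.det = 1) (h : HasFactor (E.map toLaurent * S * (E.map toLaurent)ᴴ) q) :
    HasFactor S q := by
  have hinv : E⁻¹ * E = 1 := nonsing_inv_mul E (by rw [hE]; exact isUnit_one)
  have hinv' : E⁻¹.map toLaurent * E.map toLaurent = 1 := by
    rw [← Matrix.map_mul, hinv]; simp
  have hdet : E⁻¹.det = 1 := by
    have := congrArg det hinv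
    rwa [det_mul, hE, mul_one, det_one] at this
  have := h.mul_left E⁻¹
  rw [hdet, one_mul] at this
  convert this using 1
  calc S = (E⁻¹.map toLaurent * E.map toLaurent) * S *
        (E⁻¹.map toLaurent * E.map toLaurent)ᴴ := by rw [hinv']; simp
    _ = _ := by simp only [conjTranspose_mul, Matrix.mul_assoc]

/-- A left null vector of `S(a)` becomes a row of `G`, so that row `i` of `G S G̃` vanishes at `a`;
`D` is the identity with `X - a` in place `i`. -/
lemma exists_root_removal {S : Matrix n n ℂ[T;T⁻¹]} (hS : S.IsHermitian) (hpos : PosOnCircle S)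
    {a : ℂˣ} (ha : ev a S.det = 0) :
    ∃ (G D : Matrix n n ℂ[X]) (S' : Matrix n n ℂ[T;T⁻¹]), G.det = 1 ∧
      D.det = X - Polynomial.C (a : ℂ) ∧ S'.IsHermitian ∧ PosOnCircle S' ∧
      G.map toLaurent * S * (G.map toLaurent)ᴴ = D.map toLaurent * S' * (D.map toLaurent)ᴴ := by
  have hdet : (S.map (ev a)).det = 0 := by
    rw [← RingHom.mapMatrix_apply, ← RingHom.map_det, ha]
  obtain ⟨v, hv0, hv⟩ := exists_vecMul_eq_zero_iff.mpr hdet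
  obtain ⟨i, hi⟩ := Function.ne_iff.mp hv0
  simp only [Pi.zero_apply] at hi
  set G : Matrix n n ℂ[X] :=
    (1 : Matrix n n ℂ[X]).updateRow i (fun j => Polynomial.C (v j / v i)) with hG
  have hGdet : G.det = 1 := by rw [hG, det_updateRow_one, div_self hi, map_one]
  set d : n → ℂ[X] := Function.update 1 i (X - Polynomial.C (a : ℂ)) with hd
  have hdi : d i = X - Polynomial.C (a : ℂ) := Function.update_self ..
  have hdj : ∀ j, j ≠ i → d j = 1 := fun j hj => Function.update_of_ne hj ..
  have hd0 : ∀ j, d j ≠ 0 := by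
    intro j
    rcases eq_or_ne j i with hj | hj
    · rw [hj, hdi]; exact Polynomial.X_sub_C_ne_zero (a : ℂ)
    · rw [hdj j hj]; exact one_ne_zero
  have hι0 : ∀ j, toLaurent (d j) ≠ 0 := fun j => toLaurent_ne_zero.mpr (hd0 j)
  set S₁ := G.map toLaurent * S * (G.map toLaurent)ᴴ with hS₁
  have hherm : S₁.IsHermitian := isHermitian_congr hS _
  have hpos₁ : PosOnCircle S₁ := hpos.congr (by rw [det_map_toLaurent, hGdet, map_one])
  have hrow : ∀ j, ev a (S₁ i j) = 0 := by
    intro j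
    have hGS : ∀ l, ev a ((G.map toLaurent * S) i l) = 0 := by
      intro l
      have := congrFun hv l
      rw [Matrix.mul_apply, map_sum]
      simp only [vecMul, dotProduct, Matrix.map_apply, Pi.zero_apply] at this
      calc ∑ x, ev a ((G.map toLaurent) i x * S x l) = (v i)⁻¹ * ∑ x, v x * ev a (S x l) := by
            rw [Finset.mul_sum]
            refine Finset.sum_congr rfl fun x _ => ?_
            simp only [hG, Matrix.map_apply, updateRow_self, map_mul, ev_toLaurent,
              Polynomial.eval_C]
            ring
        _ = 0 := by rw [this, mul_zero]
    rw [hS₁, Matrix.mul_apply, map_sum]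
    exact Finset.sum_eq_zero fun l _ => by rw [map_mul, hGS, zero_mul]
  have hex : ∀ b c, ∃ s, S₁ b c = toLaurent (d b) * s * star (toLaurent (d c)) := by
    have hstar : ∀ b c, star (S₁ c b) = S₁ b c := fun b c => hherm.apply b c
    intro b c
    by_cases hb : b = i
    · by_cases hc : c = i
      · rw [hb, hc, hdi]
        refine exists_eq_mul_mul_star (hstar i i) ?_ (hrow i)
        filter_upwards [hpos₁] with u hu hnu
        exact (hu hnu).posSemidef.diag_nonneg
      · obtain ⟨g, hg⟩ := exists_eq_sub_mul (hrow c)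
        refine ⟨g, ?_⟩
        rw [hb, hdi, hdj c hc, map_one, star_one, mul_one, hg]
    · by_cases hc : c = i
      · obtain ⟨g, hg⟩ := exists_eq_sub_mul (hrow b)
        refine ⟨star g, ?_⟩
        rw [hc, hdi, hdj b hb, map_one, one_mul, ← hstar, hg, star_mul]
      · exact ⟨S₁ b c, by rw [hdj b hb, hdj c hc, map_one, star_one, mul_one, one_mul]⟩
  choose s hs using hex
  have hS₁D : S₁ = (diagonal d).map toLaurent * Matrix.of s * ((diagonal d).map toLaurent)ᴴ := by
    rw [diagonal_map (map_zero _), diagonal_conjTranspose]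
    refine Matrix.ext fun b c => ?_
    rw [mul_diagonal, diagonal_mul, hs]
    rfl
  refine ⟨G, diagonal d, Matrix.of s, hGdet, ?_, ?_, ?_, hS₁D⟩
  · rw [det_diagonal, hd, Finset.prod_update_of_mem (Finset.mem_univ i)]
    simp
  · refine Matrix.ext fun b c => ?_
    have h1 := hherm.apply b c
    rw [hs, hs b c, star_mul, star_mul, star_star] at h1
    have h2 : toLaurent (d b) * star (toLaurent (d c)) ≠ 0 :=
      mul_ne_zero (hι0 b) (star_ne_zero.mpr (hι0 c))
    refine mul_left_cancel₀ h2 ?_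
    simp only [conjTranspose_apply, Matrix.of_apply]
    linear_combination h1
  · exact (hS₁D ▸ hpos₁).of_congr

end

section

/-! ### The unimodular case -/

variable {n : Type*} [Fintype n]

lemma exists_mul_T_eq_map (S : Matrix n n ℂ[T;T⁻¹]) :
    ∃ (N : ℕ) (A : Matrix n n ℂ[X]), ∀ i j, S i j * T N = toLaurent (A i j) := by
  choose k p hp using fun i j => (S i j).exists_T_pow
  refine ⟨∑ i, ∑ j, k i j, Matrix.of fun i j => p i j * X ^ ((∑ i, ∑ j, k i j) - k i j),
    fun i j => ?_⟩
  have h : k i j ≤ ∑ i, ∑ j, k i j :=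
    (Finset.single_le_sum (f := fun j => k i j) (fun _ _ => Nat.zero_le _)
      (Finset.mem_univ j)).trans
    (Finset.single_le_sum (f := fun i => ∑ j, k i j) (fun _ _ => Nat.zero_le _)
      (Finset.mem_univ i))
  rw [Matrix.of_apply, map_mul, hp, toLaurent_X_pow, mul_assoc, ← T_add]
  congr 2
  omega

variable [DecidableEq n]

-- Any factor of `K` has a determinant of the same modulus as `c`; the phase is corrected by a
-- unitary diagonal matrix, which requires at least one index.
open scoped MatrixOrder in
lemma exists_mul_conjTranspose_det_eq [Nonempty n] {K : Matrix n n ℂ} (hK : K.PosDef) {c : ℂ}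
    (hc : K.det = c * starRingEnd ℂ c) :
    ∃ B : Matrix n n ℂ, B * Bᴴ = K ∧ B.det = c := by
  obtain ⟨A, hA⟩ := CStarAlgebra.nonneg_iff_eq_star_mul_self.mp hK.posSemidef.nonneg
  rw [star_eq_conjTranspose] at hA
  obtain ⟨i⟩ := ‹Nonempty n›
  have hdet : Aᴴ.det * starRingEnd ℂ Aᴴ.det = c * starRingEnd ℂ c := by
    rw [← hc, hA, det_mul, det_conjTranspose]
    simp
  have hd0 : Aᴴ.det ≠ 0 := by
    intro h
    have := hK.det_pos
    rw [hc, ← hdet, h, zero_mul] at this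
    exact lt_irrefl _ this
  set θ := c / Aᴴ.det with hθ
  have hθ1 : θ * starRingEnd ℂ θ = 1 := by
    rw [hθ, map_div₀, div_mul_div_comm, ← hdet]
    exact div_self (mul_ne_zero hd0 ((_root_.map_ne_zero _).mpr hd0))
  refine ⟨Aᴴ * diagonal (Function.update 1 i θ), ?_, ?_⟩
  · have hW : diagonal (Function.update 1 i θ) * (diagonal (Function.update 1 i θ))ᴴ = 1 := by
      rw [diagonal_conjTranspose, diagonal_mul_diagonal, ← diagonal_one]
      congr 1
      funext j
      rcases eq_or_ne j i with rfl | hj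
      · simpa using hθ1
      · simp [hj]
    rw [conjTranspose_mul, conjTranspose_conjTranspose, Matrix.mul_assoc,
      ← Matrix.mul_assoc (diagonal _), hW, Matrix.one_mul, hA]
  · rw [det_mul, det_diagonal, Finset.prod_update_of_mem (Finset.mem_univ i)]
    simp only [Pi.one_apply, Finset.prod_const_one, mul_one]
    rw [hθ]
    field_simp

lemma eq_C_of_star_eq {f g : ℂ[T;T⁻¹]} {p q : ℂ[X]} (hf : f = toLaurent p)
    (hg : g = toLaurent q) (h : star g = f) : f = LaurentPolynomial.C (f.coeff 0) := by
  ext k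
  rw [C_apply]
  rcases lt_trichotomy k 0 with hk | rfl | hk
  · rw [if_neg hk.ne, hf, toLaurent_coeff_of_neg _ hk]
  · simp
  · rw [if_neg hk.ne', ← h, coeff_star, hg, toLaurent_coeff_of_neg _ (by omega), map_zero]

lemma hasFactor_of_polynomial [Nonempty n] {S : Matrix n n ℂ[T;T⁻¹]} (hS : S.IsHermitian)
    (hpos : PosOnCircle S) {c : ℂ}
    (hdet : S.det = LaurentPolynomial.C (c * starRingEnd ℂ c)) {M : Matrix n n ℂ[X]}
    (hM : S = M.map toLaurent) : HasFactor S (Polynomial.C c) := by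
  set K : Matrix n n ℂ := Matrix.of fun i j => (S i j).coeff 0 with hK
  have hSK : S = K.map LaurentPolynomial.C := by
    refine Matrix.ext fun i j => ?_
    exact eq_C_of_star_eq (congrFun (congrFun hM i) j) (congrFun (congrFun hM j) i)
      (hS.apply i j)
  obtain ⟨u, -, hu⟩ := hpos.exists_posDef
  have hKu : S.map (ev u) = K := by
    rw [hSK]
    refine Matrix.ext fun i j => ?_
    simp
  have hKdet : K.det = c * starRingEnd ℂ c := by
    have := congrArg (ev u) hdet
    rwa [RingHom.map_det, RingHom.mapMatrix_apply, hKu, ev_C] at this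
  obtain ⟨B, hB, hBdet⟩ := exists_mul_conjTranspose_det_eq (hKu ▸ hu) hKdet
  refine ⟨B.map Polynomial.C, ?_, ?_⟩
  · have h1 : (B.map Polynomial.C).map toLaurent = B.map LaurentPolynomial.C := by
      refine Matrix.ext fun i j => ?_
      simp
    have h2 : (B.map LaurentPolynomial.C)ᴴ = Bᴴ.map LaurentPolynomial.C := by
      refine Matrix.ext fun i j => ?_
      simp
    rw [h1, h2, ← Matrix.map_mul, hB, hSK]
  · rw [← RingHom.mapMatrix_apply, ← RingHom.map_det, hBdet]

lemma exists_det_map_eval_zero {S : Matrix n n ℂ[T;T⁻¹]} {c : ℂ}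
    (hdet : S.det = LaurentPolynomial.C c) {k : n → ℕ} {M : Matrix n n ℂ[X]}
    (hM : S * diagonal (fun i => T (k i)) = M.map toLaurent) (hk : k ≠ 0) :
    (M.map (Polynomial.eval 0)).det = 0 := by
  have h1 : M.det = Polynomial.C c * X ^ (∑ i, k i) := by
    apply toLaurent_injective
    rw [← det_map_toLaurent, ← hM, det_mul, hdet, det_diagonal, map_mul, toLaurent_C,
      toLaurent_X_pow]
    congr 1
    rw [← toLaurent_X_pow, ← Finset.prod_pow_eq_pow_sum, map_prod]
    simp
  have h2 : (M.map (Polynomial.eval 0)).det = Polynomial.eval 0 M.det := by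
    have := RingHom.map_det (Polynomial.evalRingHom (0 : ℂ)) M
    rw [RingHom.mapMatrix_apply] at this
    exact this.symm
  obtain ⟨i, hi⟩ := Function.ne_iff.mp hk
  have h3 : ∑ i, k i ≠ 0 := by
    intro h
    exact hi (Finset.sum_eq_zero_iff.mp h i (Finset.mem_univ i))
  rw [h2, h1]
  simp [h3]

/-- An elementary congruence lowering one of the column indices `k i`, when the columns, scaled to
be polynomial, are dependent at the origin. -/
lemma exists_index_reduction {S : Matrix n n ℂ[T;T⁻¹]} {k : n → ℕ} {M : Matrix n n ℂ[X]}
    (hM : S * diagonal (fun i => T (k i)) = M.map toLaurent)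
    (hdet : (M.map (Polynomial.eval 0)).det = 0) :
    ∃ (i : n) (E : Matrix n n ℂ[X]) (r : n → ℂ[X]), E.det = 1 ∧
      (∀ l, (E.map toLaurent * S * (E.map toLaurent)ᴴ) l i * T (k i) =
        T 1 * toLaurent ((E *ᵥ r) l)) ∧
      ∀ l j, j ≠ i → (E.map toLaurent * S * (E.map toLaurent)ᴴ) l j * T (k j) =
        toLaurent ((E * M) l j) := by
  obtain ⟨w, hw0, hw⟩ := exists_mulVec_eq_zero_iff.mpr hdet
  obtain ⟨i₀, hi₀⟩ := Function.ne_iff.mp hw0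
  -- Maximality of `k i` on the support of `w` keeps the exponents `k i - k j` below from being
  -- truncated where they matter, so `E` is polynomial.
  obtain ⟨i, hi, hmax⟩ := Finset.exists_max_image (Finset.univ.filter fun j => w j ≠ 0) k
    ⟨i₀, by simpa using hi₀⟩
  have hwi : w i ≠ 0 := by simpa using hi
  have hmax' : ∀ j, w j ≠ 0 → k j ≤ k i := fun j hj => hmax j (by simpa using hj)
  have hr : ∀ l, ∃ r, ∑ j, M l j * Polynomial.C (w j / w i) = X * r := by
    intro l
    have : (X : ℂ[X]) ∣ ∑ j, M l j * Polynomial.C (w j / w i) := by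
      rw [X_dvd_iff, coeff_zero_eq_eval_zero, eval_finsetSum]
      have h1 := congrFun hw l
      simp only [mulVec, dotProduct, Matrix.map_apply, Pi.zero_apply] at h1
      simp only [eval_mul, eval_C, mul_div_assoc']
      rw [← Finset.sum_div, h1, zero_div]
    exact this
  choose r hr using hr
  -- Chosen so that column `i` of `S Ẽ`, scaled by `T (k i)`, is the combination `∑ (w j / w i) M_j`
  -- of columns of `M`, which vanishes at the origin.
  set x : n → ℂ[X] := fun j => Polynomial.C (starRingEnd ℂ (w j / w i)) * X ^ (k i - k j) with hx
  set E : Matrix n n ℂ[X] := (1 : Matrix n n ℂ[X]).updateRow i x with hE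
  have hEH : (E.map toLaurent)ᴴ = (1 : Matrix n n ℂ[T;T⁻¹]).updateCol i
      (star (toLaurent ∘ x)) := by
    rw [hE, map_updateRow, ← updateCol_conjTranspose]
    congr 1
    simp
  have hSE : S * (E.map toLaurent)ᴴ = S.updateCol i (S *ᵥ star (toLaurent ∘ x)) := by
    rw [hEH, mul_updateCol, Matrix.mul_one]
  have hMe : ∀ l j, S l j * T (k j) = toLaurent (M l j) := by
    intro l j
    have := congrFun (congrFun hM l) j
    rwa [mul_diagonal, Matrix.map_apply] at this
  refine ⟨i, E, r, ?_, ?_, ?_⟩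
  · rw [hE, det_updateRow_one]
    simp only [hx]
    rw [div_self hwi]
    simp
  · have hcol : ∀ l, (S * (E.map toLaurent)ᴴ) l i * T (k i) = T 1 * toLaurent (r l) := by
      intro l
      rw [← toLaurent_X, ← map_mul, ← hr, hSE, updateCol_self, mulVec, dotProduct,
        Finset.sum_mul, map_sum]
      refine Finset.sum_congr rfl fun j _ => ?_
      rw [map_mul, ← hMe, toLaurent_C]
      by_cases hj : w j = 0
      · simp [hx, hj]
      · have hk : (k j : ℤ) = -((k i - k j : ℕ) : ℤ) + k i := by
          have := hmax' j hj
          omega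
        rw [hk, T_add]
        simp only [hx, Pi.star_apply, Function.comp_apply, map_mul, toLaurent_C,
          toLaurent_X_pow, star_mul', star_laurent_C, star_laurent_T, Complex.conj_conj]
        ring
    intro l
    rw [Matrix.mul_assoc, Matrix.mul_apply, Finset.sum_mul, mulVec, dotProduct, map_sum,
      Finset.mul_sum]
    refine Finset.sum_congr rfl fun j _ => ?_
    rw [mul_assoc, hcol, map_mul, Matrix.map_apply]
    ring
  · intro l j hj
    rw [Matrix.mul_assoc, Matrix.mul_apply, Finset.sum_mul, Matrix.mul_apply, map_sum]
    refine Finset.sum_congr rfl fun l' _ => ?_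
    rw [mul_assoc, hSE, updateCol_ne hj, hMe, map_mul, Matrix.map_apply]

/-- While `k ≠ 0`, `det M` is a constant times a positive power of `X`, so the columns of `M` are
dependent at the origin and the sum of the indices can be lowered. -/
lemma hasFactor_of_det_const_of_index [Nonempty n] {c : ℂ} (d : ℕ) :
    ∀ (S : Matrix n n ℂ[T;T⁻¹]), S.IsHermitian → PosOnCircle S →
      S.det = LaurentPolynomial.C (c * starRingEnd ℂ c) →
      ∀ (k : n → ℕ) (M : Matrix n n ℂ[X]), ∑ i, k i = d →
      S * diagonal (fun i => T (k i)) = M.map toLaurent → HasFactor S (Polynomial.C c) := by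
  induction d using Nat.strong_induction_on with
  | _ d ih =>
  intro S hS hpos hdet k M hk hM
  by_cases hk0 : k = 0
  · refine hasFactor_of_polynomial hS hpos hdet (M := M) ?_
    rw [← hM, hk0]
    simp
  obtain ⟨i, E, r, hE, hi, hne⟩ := exists_index_reduction hM (exists_det_map_eval_zero hdet hM hk0)
  have hEdet : (E.map toLaurent).det = 1 := by rw [det_map_toLaurent, hE, map_one]
  set S' := E.map toLaurent * S * (E.map toLaurent)ᴴ with hS'
  have hS'h : S'.IsHermitian := isHermitian_congr hS _
  have hS'p : PosOnCircle S' := hpos.congr hEdet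
  -- Otherwise the diagonal entry `S' i i` would be a self-adjoint polynomial, hence constant, and
  -- divisible by `X`, hence zero, against positivity.
  have hki : k i ≠ 0 := by
    intro h0
    have h1 := hi i
    rw [h0, Nat.cast_zero, T_zero, mul_one, ← toLaurent_X, ← map_mul] at h1
    have h2 := eq_C_of_star_eq h1 h1 (hS'h.apply i i)
    refine hS'p.diag_ne_zero i ?_
    have h3 : (S' i i).coeff 0 = 0 := by
      have h4 : (toLaurent (X * (E *ᵥ r) i)).coeff ((0 : ℕ) : ℤ) = 0 := by
        rw [toLaurent_coeff_natCast]
        simp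
      rw [h1]
      exact h4
    rw [h2, h3, map_zero]
  refine HasFactor.of_congr hE ?_
  refine ih (∑ j, Function.update k i (k i - 1) j) ?_ S' hS'h hS'p ?_ (Function.update k i (k i - 1))
    ((E * M).updateCol i (E *ᵥ r)) rfl ?_
  · rw [← hk]
    refine Finset.sum_lt_sum (fun j _ => ?_) ⟨i, Finset.mem_univ i, ?_⟩
    · rcases eq_or_ne j i with rfl | hj
      · simp
      · simp [hj]
    · simp only [Function.update_self]
      omega
  · rw [hS', det_mul, det_mul, det_conjTranspose, hEdet, hdet]
    simp
  · refine Matrix.ext fun l j => ?_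
    rw [mul_diagonal, Matrix.map_apply]
    rcases eq_or_ne j i with rfl | hj
    · rw [updateCol_self, Function.update_self]
      have h1 : ((k j - 1 : ℕ) : ℤ) = k j + -1 := by omega
      rw [h1, T_add, ← mul_assoc, hi, mul_comm, ← mul_assoc, ← T_add]
      simp
    · rw [updateCol_ne hj, Function.update_of_ne hj, hne l j hj]

lemma hasFactor_of_det_const [Nonempty n] {S : Matrix n n ℂ[T;T⁻¹]} (hS : S.IsHermitian)
    (hpos : PosOnCircle S) {c : ℂ}
    (hdet : S.det = LaurentPolynomial.C (c * starRingEnd ℂ c)) :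
    HasFactor S (Polynomial.C c) := by
  obtain ⟨N, A, hA⟩ := exists_mul_T_eq_map S
  refine hasFactor_of_det_const_of_index _ S hS hpos hdet (fun _ => N) A rfl ?_
  refine Matrix.ext fun i j => ?_
  rw [mul_diagonal, hA, Matrix.map_apply]

/-! ### Factorization with a prescribed determinant not vanishing at the origin -/

lemma hasFactor_of_natDegree [Nonempty n] (d : ℕ) :
    ∀ (S : Matrix n n ℂ[T;T⁻¹]) (q : ℂ[X]), S.IsHermitian → PosOnCircle S → q.natDegree = d →
      q.eval 0 ≠ 0 → S.det = toLaurent q * star (toLaurent q) → HasFactor S q := by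
  induction d with
  | zero =>
    intro S q hS hpos hq hq0 hdet
    obtain ⟨c, rfl⟩ := natDegree_eq_zero.mp hq
    refine hasFactor_of_det_const hS hpos ?_
    rw [hdet, toLaurent_C, star_laurent_C, map_mul]
  | succ d ih =>
    intro S q hS hpos hq hq0 hdet
    obtain ⟨z, hz⟩ := IsAlgClosed.exists_root q (by
      intro h
      have := natDegree_eq_zero_iff_degree_le_zero.mpr h.le
      omega)
    have hz0 : z ≠ 0 := by
      rintro rfl
      exact hq0 hz
    obtain ⟨q, rfl⟩ := dvd_iff_isRoot.mpr hz
    obtain ⟨G, D, S', hG, hD, hS'h, hS'p, hGD⟩ := exists_root_removal hS hpos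
      (a := Units.mk0 z hz0) (by rw [hdet, map_mul, ev_toLaurent]; simp)
    rw [Units.val_mk0] at hD
    refine HasFactor.of_congr hG ?_
    rw [hGD, ← hD]
    refine HasFactor.mul_left (ih S' q hS'h hS'p ?_ ?_ ?_) D
    · have hq1 : q ≠ 0 := by
        rintro rfl
        simp at hq
      rw [natDegree_mul (X_sub_C_ne_zero z) hq1, natDegree_X_sub_C] at hq
      omega
    · intro h
      exact hq0 (by rw [eval_mul, h, mul_zero])
    · have h1 := congrArg det hGD
      simp only [det_mul, det_conjTranspose, det_map_toLaurent, hG, map_one, hD, hdet, star_one,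
        star_mul', mul_one, one_mul, map_mul] at h1
      have h0 : toLaurent (X - Polynomial.C z) ≠ 0 := toLaurent_ne_zero.mpr (X_sub_C_ne_zero z)
      refine mul_left_cancel₀ (mul_ne_zero h0 (star_ne_zero.mpr h0)) ?_
      linear_combination -h1

theorem hasFactor_of_eval_zero_ne_zero [Nonempty n] {S : Matrix n n ℂ[T;T⁻¹]} {q : ℂ[X]}
    (hS : S.IsHermitian) (hpos : PosOnCircle S) (hq0 : q.eval 0 ≠ 0)
    (hdet : S.det = toLaurent q * star (toLaurent q)) : HasFactor S q :=
  hasFactor_of_natDegree _ S q hS hpos rfl hq0 hdet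

end

section

/-! ### The degree of a spectral factor -/

variable {n : Type*} [Fintype n]

lemma coeff_mul_T (f : ℂ[T;T⁻¹]) (k l : ℤ) : (f * T k).coeff l = f.coeff (l - k) := by
  induction f using LaurentPolynomial.induction_on' with
  | add p q hp hq => rw [add_mul]; simp [hp, hq]
  | C_mul_T j a =>
    rw [mul_T_assoc, ← single_eq_C_mul_T, ← single_eq_C_mul_T]
    simp only [AddMonoidAlgebra.coeff_single, Finsupp.single_apply, eq_sub_iff_add_eq]

lemma coeff_C_mul (f : ℂ[T;T⁻¹]) (a : ℂ) (l : ℤ) :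
    (LaurentPolynomial.C a * f).coeff l = a * f.coeff l := by
  rw [← LaurentPolynomial.smul_eq_C_mul]
  simp

section

variable [DecidableEq n]

/-- Multiplying `P P̃ = S` by `adj P` shows that `det P · z^N P̃` is polynomial; as `det P(0) ≠ 0`,
so is `z^N P̃`. -/
lemma natDegree_le_of_factor {S : Matrix n n ℂ[T;T⁻¹]} {P A : Matrix n n ℂ[X]} {N : ℕ}
    (hP : P.map toLaurent * (P.map toLaurent)ᴴ = S) (hdet : P.det.eval 0 ≠ 0)
    (hA : ∀ i j, S i j * T N = toLaurent (A i j)) (i j : n) : (P i j).natDegree ≤ N := by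
  have h1 : toLaurent P.det * (star (toLaurent (P i j)) * T N) =
      toLaurent ((P.adjugate * A) j i) := by
    have h2 : P.adjugate.map toLaurent * S = toLaurent P.det • (P.map toLaurent)ᴴ := by
      rw [← hP, ← Matrix.mul_assoc, ← Matrix.map_mul, adjugate_mul]
      refine Matrix.ext fun a b => ?_
      simp [Matrix.mul_apply, Matrix.one_apply, Matrix.smul_apply, apply_ite toLaurent]
    have h3 := congrFun (congrFun h2 j) i
    rw [Matrix.smul_apply, conjTranspose_apply, Matrix.map_apply, smul_eq_mul] at h3
    rw [← mul_assoc, ← h3, Matrix.mul_apply, Finset.sum_mul, Matrix.mul_apply, map_sum]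
    refine Finset.sum_congr rfl fun l _ => ?_
    rw [mul_assoc, hA, map_mul, Matrix.map_apply]
  obtain ⟨s, hs⟩ := mem_range_of_toLaurent_mul hdet h1
  rw [natDegree_le_iff_coeff_eq_zero]
  intro m hm
  have h4 := congrArg (fun f : ℂ[T;T⁻¹] => f.coeff (-(m : ℤ) + N)) hs
  simp only [coeff_mul_T] at h4
  rw [toLaurent_coeff_of_neg s (by omega), coeff_star] at h4
  rw [show -(-(m : ℤ) + N - N) = m by ring, toLaurent_coeff_natCast] at h4
  exact (map_eq_zero _).mp h4

lemma coeff_det_eq_det_map_coeff {P : Matrix n n ℂ[X]} {N : ℕ}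
    (hP : ∀ i j, (P i j).natDegree ≤ N) :
    P.det.coeff (Fintype.card n * N) = (P.map (fun p => p.coeff N)).det := by
  rw [det_apply, det_apply, finsetSum_coeff]
  refine Finset.sum_congr rfl fun σ _ => ?_
  rw [Polynomial.coeff_smul, ← Finset.card_univ, coeff_prod_of_natDegree_le]
  · rfl
  · exact fun _ _ => hP _ _

/-! ### Moving zeros of the determinant from infinity to the origin -/

/-- `Q` projects onto the line through `u`; the determinant is a rank-one update of the identity. -/
lemma exists_orthogonal_projection {u : n → ℂ} (hu : u ≠ 0) :
    ∃ Q : Matrix n n ℂ, Qᴴ = Q ∧ Q * Q = Q ∧ (∀ B : Matrix n n ℂ, B *ᵥ u = 0 → B * Q = 0) ∧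
      (1 + (X - 1 : ℂ[X]) • Q.map Polynomial.C).det = X := by
  set s : ℂ := star u ⬝ᵥ u with hs
  have hs0 : s ≠ 0 := by
    rw [hs, Ne, dotProduct_star_self_eq_zero]
    exact hu
  have hsr : starRingEnd ℂ s = s := by
    simp [hs, dotProduct, map_sum, mul_comm]
  refine ⟨s⁻¹ • vecMulVec u (star u), ?_, ?_, ?_, ?_⟩
  · rw [conjTranspose_smul, conjTranspose_vecMulVec, star_star, star_inv₀]
    congr 2
  · rw [smul_mul_smul_comm, vecMulVec_mul_vecMulVec, ← hs, vecMulVec_smul, smul_smul]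
    congr 1
    field_simp
  · intro B hB
    rw [Matrix.mul_smul, mul_vecMulVec, hB]
    simp
  · have h1 : (X - 1 : ℂ[X]) • (s⁻¹ • vecMulVec u (star u)).map Polynomial.C =
        replicateCol Unit (fun i => (X - 1 : ℂ[X]) * Polynomial.C (s⁻¹ * u i)) *
          replicateRow Unit (fun i => Polynomial.C (star (u i))) := by
      refine Matrix.ext fun i j => ?_
      simp only [Matrix.smul_apply, Matrix.map_apply, vecMulVec_apply, smul_eq_mul,
        Matrix.mul_apply, replicateCol_apply, replicateRow_apply, Pi.star_apply, map_mul,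
        Finset.univ_unique, Finset.sum_singleton]
      ring
    rw [h1, det_one_add_replicateCol_mul_replicateRow]
    have h2 (t : ℂ) : (fun i => Polynomial.C (star (u i))) ⬝ᵥ
        (fun i => (X - 1 : ℂ[X]) * Polynomial.C (t * u i)) =
        (X - 1) * Polynomial.C (t * s) := by
      rw [hs]
      simp only [dotProduct, Finset.mul_sum, map_sum, map_mul, Pi.star_apply]
      refine Finset.sum_congr rfl fun i _ => ?_
      ring
    rw [h2, inv_mul_cancel₀ hs0]
    simp

/-- A determinant of deficient degree means that the coefficient of `X ^ N` in `P` kills some `u ≠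
0`. With `Q` the projection onto `u`, the factor `W = 1 + (X - 1) Q` is unitary on the circle, and
`P Q` has degree below `N`, so `P W` stays within degree `N`. -/
lemma exists_factor_det_eq_X_mul {P : Matrix n n ℂ[X]} {N : ℕ}
    (hP : ∀ i j, (P i j).natDegree ≤ N) (hdet : P.det.natDegree < Fintype.card n * N) :
    ∃ P' : Matrix n n ℂ[X], (∀ i j, (P' i j).natDegree ≤ N) ∧
      P'.map toLaurent * (P'.map toLaurent)ᴴ = P.map toLaurent * (P.map toLaurent)ᴴ ∧
      P'.det = X * P.det := by
  have h0 : (P.map (fun p => p.coeff N)).det = 0 := by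
    rw [← coeff_det_eq_det_map_coeff hP, coeff_eq_zero_of_natDegree_lt hdet]
  obtain ⟨u, hu, hPu⟩ := exists_mulVec_eq_zero_iff.mpr h0
  obtain ⟨Q, hQH, hQQ, hQ0, hQdet⟩ := exists_orthogonal_projection hu
  set W : Matrix n n ℂ[X] := 1 + (X - 1 : ℂ[X]) • Q.map Polynomial.C with hW
  have hWW : W.map toLaurent * (W.map toLaurent)ᴴ = 1 := by
    set R := Q.map LaurentPolynomial.C with hR
    have hRH : Rᴴ = R := by
      conv_rhs => rw [hR, ← hQH]
      refine Matrix.ext fun i j => ?_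
      simp [hR]
    have hRR : R * R = R := by rw [hR, ← Matrix.map_mul, hQQ]
    have hWR : W.map toLaurent = 1 + (T 1 - 1 : ℂ[T;T⁻¹]) • R := by
      refine Matrix.ext fun i j => ?_
      simp [hW, hR, Matrix.one_apply, apply_ite toLaurent]
    have hWRH : (W.map toLaurent)ᴴ = 1 + (T (-1) - 1 : ℂ[T;T⁻¹]) • R := by
      rw [hWR, conjTranspose_add, conjTranspose_one, conjTranspose_smul, hRH]
      simp
    have hT : (T 1 : ℂ[T;T⁻¹]) * T (-1) = 1 := by rw [← T_add]; simp
    rw [hWRH, hWR, add_mul, one_mul, mul_add, mul_one, smul_mul_smul_comm, hRR, add_assoc,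
      ← add_smul, ← add_smul]
    have : (T (-1) - 1 : ℂ[T;T⁻¹]) + ((T 1 - 1) + (T 1 - 1) * (T (-1) - 1)) = 0 := by
      linear_combination hT
    rw [this, zero_smul, add_zero]
  refine ⟨P * W, ?_, ?_, ?_⟩
  · intro i j
    rw [natDegree_le_iff_coeff_eq_zero]
    intro m hm
    have hPQ : ∀ k, N ≤ k → ((P * Q.map Polynomial.C) i j).coeff k = 0 := by
      intro k hk
      rw [Matrix.mul_apply, finsetSum_coeff]
      simp only [Matrix.map_apply, Polynomial.coeff_mul_C]
      rcases hk.eq_or_lt with rfl | hk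
      · exact congrFun (congrFun (hQ0 _ hPu) i) j
      · exact Finset.sum_eq_zero fun l _ => by
          rw [coeff_eq_zero_of_natDegree_lt ((hP i l).trans_lt hk), zero_mul]
    have hsplit : (P * W) i j = P i j + X * (P * Q.map Polynomial.C) i j -
        (P * Q.map Polynomial.C) i j := by
      rw [hW, mul_add, mul_one, Matrix.mul_smul, Matrix.add_apply, Matrix.smul_apply, smul_eq_mul]
      ring
    obtain ⟨k, rfl⟩ := Nat.exists_eq_add_one_of_ne_zero (show m ≠ 0 by omega)
    rw [hsplit, coeff_sub, coeff_add, coeff_X_mul, hPQ k (by omega), hPQ (k + 1) (by omega),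
      coeff_eq_zero_of_natDegree_lt ((hP i j).trans_lt hm)]
    simp
  · rw [Matrix.map_mul, conjTranspose_mul, Matrix.mul_assoc, ← Matrix.mul_assoc (W.map toLaurent),
      hWW, Matrix.one_mul]
  · rw [det_mul, hQdet, mul_comm]

lemma exists_factor_det_eq_X_pow_mul {P : Matrix n n ℂ[X]} {N : ℕ}
    (hP : ∀ i j, (P i j).natDegree ≤ N) (hP0 : P.det ≠ 0) (k : ℕ)
    (hdet : k + P.det.natDegree ≤ Fintype.card n * N) :
    ∃ P' : Matrix n n ℂ[X], (∀ i j, (P' i j).natDegree ≤ N) ∧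
      P'.map toLaurent * (P'.map toLaurent)ᴴ = P.map toLaurent * (P.map toLaurent)ᴴ ∧
      P'.det = X ^ k * P.det := by
  induction k with
  | zero => exact ⟨P, hP, rfl, by simp⟩
  | succ k ih =>
    obtain ⟨P₁, h1, h2, h3⟩ := ih (by omega)
    obtain ⟨P₂, h4, h5, h6⟩ := exists_factor_det_eq_X_mul h1 (by
      rw [h3, natDegree_X_pow_mul _ hP0]
      omega)
    exact ⟨P₂, h4, h5.trans h2, by rw [h6, h3, pow_succ]; ring⟩

/-- Spectral factorization of a Laurent polynomial matrix of degree at most `N`, with prescribed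
determinant of degree at most `card n * N`. -/
theorem exists_factor_natDegree_le [Nonempty n] {S : Matrix n n ℂ[T;T⁻¹]} (hS : S.IsHermitian)
    (hpos : PosOnCircle S) {N : ℕ} {A : Matrix n n ℂ[X]}
    (hA : ∀ i j, S i j * T N = toLaurent (A i j)) {p : ℂ[X]} (hp0 : p ≠ 0)
    (hdeg : p.natDegree ≤ Fintype.card n * N)
    (hp : S.det = toLaurent p * star (toLaurent p)) :
    ∃ P : Matrix n n ℂ[X], (∀ i j, (P i j).natDegree ≤ N) ∧
      P.map toLaurent * (P.map toLaurent)ᴴ = S ∧ P.det = p := by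
  obtain ⟨q, hpq, hq⟩ := exists_eq_pow_rootMultiplicity_mul_and_not_dvd p hp0 0
  set k := p.rootMultiplicity 0
  rw [map_zero, sub_zero] at hpq hq
  rw [X_dvd_iff, coeff_zero_eq_eval_zero] at hq
  have hq0 : q ≠ 0 := by
    rintro rfl
    simp at hq
  -- `z^k` times its adjoint is 1, so `q` is again a spectral factor.
  have hdetq : S.det = toLaurent q * star (toLaurent q) := by
    have hT : (T k : ℂ[T;T⁻¹]) * T (-k) = 1 := by rw [← T_add]; simp
    rw [hp, hpq, map_mul, toLaurent_X_pow, star_mul', star_laurent_T]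
    linear_combination (toLaurent q * star (toLaurent q)) * hT
  obtain ⟨P, hPS, hPq⟩ := hasFactor_of_eval_zero_ne_zero hS hpos hq hdetq
  have hPN := natDegree_le_of_factor hPS (by rwa [hPq]) hA
  rw [hpq, natDegree_X_pow_mul _ hq0] at hdeg
  obtain ⟨P', h1, h2, h3⟩ := exists_factor_det_eq_X_pow_mul hPN (by rwa [hPq]) k
    (by rw [hPq]; omega)
  exact ⟨P', h1, h2.trans hPS, by rw [h3, hPq, ← hpq]⟩

end

/-- The adjoint has no positive powers, so only the coefficient of `X ^ N` in `p` could contribute.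
This keeps the top coefficient of `P` nonzero when that of `S` is. -/
lemma coeff_mul_star_eq_zero {p q : ℂ[X]} {N : ℕ} (hp : p.natDegree ≤ N) (hN : p.coeff N = 0) :
    (toLaurent p * star (toLaurent q)).coeff (N : ℤ) = 0 := by
  rw [p.as_sum_range_C_mul_X_pow' (Nat.lt_succ_of_le hp), map_sum, Finset.sum_mul]
  simp only [AddMonoidAlgebra.coeff_sum, Finsupp.finsetSum_apply]
  refine Finset.sum_eq_zero fun m hm => ?_
  rw [toLaurent_C_mul_X_pow, mul_assoc, coeff_C_mul, mul_comm (T _), coeff_mul_T, coeff_star]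
  rcases (Nat.lt_succ_iff.mp (Finset.mem_range.mp hm)).eq_or_lt with rfl | hlt
  · rw [hN, zero_mul]
  · rw [toLaurent_coeff_of_neg _ (by omega), map_zero, mul_zero]

end

/-! ### Matrix functions and Laurent polynomial matrices -/

lemma isClosed_setOf_posSemidef (n : Type*) [Fintype n] :
    IsClosed {M : Matrix n n ℂ | M.PosSemidef} := by
  have h : {M : Matrix n n ℂ | M.PosSemidef} =
      {M | Mᴴ = M} ∩ ⋂ x : n → ℂ, {M | 0 ≤ star x ⬝ᵥ (M *ᵥ x)} := by
    ext M
    simp [posSemidef_iff_dotProduct_mulVec, IsHermitian]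
  rw [h]
  refine (isClosed_eq (by fun_prop) continuous_id).inter (isClosed_iInter fun x => ?_)
  exact isClosed_le continuous_const (by fun_prop)

lemma finite_setOf_ev_eq_zero {f : ℂ[T;T⁻¹]} (hf : f ≠ 0) : {u : ℂˣ | ev u f = 0}.Finite := by
  by_contra h
  refine hf (laurent_eq_zero_of_infinite (Set.Infinite.image Units.val_injective.injOn h) ?_)
  rintro u ⟨v, hv, hvu⟩
  rwa [← Units.ext hvu]

variable {m N : ℕ} {C : ℤ → Matrix (Fin m) (Fin m) ℂ}

/-- The Laurent polynomial matrix with coefficients `C n`, `-N ≤ n ≤ N`. -/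
noncomputable def laurentPolyMatrix (N : ℕ) (C : ℤ → Matrix (Fin m) (Fin m) ℂ) :
    Matrix (Fin m) (Fin m) ℂ[T;T⁻¹] :=
  Matrix.of fun i j => ∑ k ∈ Finset.Icc (-(N : ℤ)) N, LaurentPolynomial.C (C k i j) * T k

lemma map_ev_laurentPolyMatrix (u : ℂˣ) :
    (laurentPolyMatrix N C).map (ev u) = laurentMatrix N C u := by
  refine Matrix.ext fun i j => ?_
  simp only [laurentPolyMatrix, laurentMatrix, Matrix.map_apply, Matrix.of_apply, map_sum, map_mul,
    ev_C, ev_T, Matrix.sum_apply, Matrix.smul_apply, smul_eq_mul]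
  exact Finset.sum_congr rfl fun k _ => mul_comm _ _

lemma laurentPolyMatrix_mul_T (i j : Fin m) :
    laurentPolyMatrix N C i j * T N = toLaurent
      ((Matrix.of fun i j => ∑ k ∈ Finset.Icc (-(N : ℤ)) N,
        Polynomial.C (C k i j) * X ^ (k + N).toNat : Matrix (Fin m) (Fin m) ℂ[X]) i j) := by
  simp only [laurentPolyMatrix, Matrix.of_apply, Finset.sum_mul, map_sum]
  refine Finset.sum_congr rfl fun k hk => ?_
  rw [toLaurent_C_mul_X_pow, mul_T_assoc, Int.toNat_of_nonneg]
  have := (Finset.mem_Icc.mp hk).1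
  omega

lemma coeff_laurentPolyMatrix (i j : Fin m) :
    (laurentPolyMatrix N C i j).coeff (N : ℤ) = C N i j := by
  simp only [laurentPolyMatrix, Matrix.of_apply, ← single_eq_C_mul_T, AddMonoidAlgebra.coeff_sum,
    Finsupp.finsetSum_apply, AddMonoidAlgebra.coeff_single, Finsupp.single_apply]
  rw [Finset.sum_ite_eq_of_mem']
  simp

lemma PosDefAEOnCircle.exists_posDef {F : ℂ → Matrix (Fin m) (Fin m) ℂ}
    (h : PosDefAEOnCircle F) : ∃ z : ℂ, z ≠ 0 ∧ (F z).PosDef := by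
  obtain ⟨θ, hθ, hF⟩ := (MeasureTheory.Measure.dense_of_ae h).exists_mem_open
    (isOpen_Ioo (a := 0) (b := 2 * Real.pi)) ⟨Real.pi, Real.pi_pos, by linarith [Real.pi_pos]⟩
  exact ⟨_, Complex.exp_ne_zero _, hθ ⟨hF.1.le, hF.2⟩⟩

/-- A set of full measure is dense and semidefiniteness is a closed condition. The point `1` is left
out only because the angle runs over the open interval `(0, 2π)`. -/
lemma posSemidef_laurentMatrix (h : PosDefAEOnCircle (laurentMatrix N C)) {u : ℂˣ}
    (hu : ‖(u : ℂ)‖ = 1) (hu1 : u ≠ 1) : (laurentMatrix N C u).PosSemidef := by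
  set φ : ℝ → Matrix (Fin m) (Fin m) ℂ :=
    fun θ => laurentMatrix N C (Complex.exp (θ * Complex.I)) with hφ
  have hφc : Continuous φ := by
    rw [hφ]
    unfold laurentMatrix
    refine continuous_finsetSum _ fun k _ => ?_
    refine Continuous.fun_smul ?_ continuous_const
    exact Continuous.zpow₀ (by fun_prop) k fun _ => Or.inl (Complex.exp_ne_zero _)
  have hclosed : IsClosed {θ | (φ θ).PosSemidef} :=
    (isClosed_setOf_posSemidef (Fin m)).preimage hφc
  have hsub : Set.Ioo 0 (2 * Real.pi) ⊆ {θ | (φ θ).PosSemidef} := by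
    refine ((MeasureTheory.Measure.dense_of_ae h).open_subset_closure_inter isOpen_Ioo).trans
      (closure_minimal ?_ hclosed)
    rintro θ ⟨hθ, hF⟩
    exact (hF ⟨hθ.1.le, hθ.2⟩).posSemidef
  obtain ⟨θ, hθ, hθu⟩ : ∃ θ ∈ Set.Ioo 0 (2 * Real.pi), Complex.exp (θ * Complex.I) = u := by
    have h1 : Complex.exp (Complex.arg u * Complex.I) = u := by
      have := Complex.norm_mul_exp_arg_mul_I (u : ℂ)
      rwa [hu, Complex.ofReal_one, one_mul] at this
    have h0 : Complex.arg u ≠ 0 := by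
      intro h0
      rw [h0] at h1
      exact hu1 (Units.ext (by simpa using h1.symm))
    rcases h0.lt_or_gt with hlt | hgt
    · refine ⟨Complex.arg u + 2 * Real.pi, ⟨?_, by linarith⟩, ?_⟩
      · linarith [Complex.neg_pi_lt_arg (u : ℂ), Real.pi_pos]
      · push_cast
        rw [add_mul, Complex.exp_add, Complex.exp_two_pi_mul_I, mul_one, h1]
    · exact ⟨Complex.arg u, ⟨hgt, by linarith [Complex.arg_le_pi (u : ℂ), Real.pi_pos]⟩, h1⟩
  have h1 : (laurentMatrix N C (Complex.exp (θ * Complex.I))).PosSemidef := hsub hθ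
  rwa [hθu] at h1

lemma isHermitian_laurentPolyMatrix (h : PosDefAEOnCircle (laurentMatrix N C)) :
    (laurentPolyMatrix N C).IsHermitian := by
  refine Matrix.ext fun i j => ?_
  rw [← sub_eq_zero]
  refine laurent_eq_zero_of_infinite
    ((infinite_circle.sdiff (Set.finite_singleton 1)).image Units.val_injective.injOn) ?_
  rintro u ⟨v, ⟨hv, hv1⟩, hvu⟩
  rw [Units.ext hvu] at hv hv1
  have h1 := (posSemidef_laurentMatrix h hv hv1).isHermitian
  rw [← map_ev_laurentPolyMatrix, IsHermitian, ← ev_matrix_conjTranspose hv] at h1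
  have h2 := congrFun (congrFun h1 i) j
  rw [Matrix.map_apply, Matrix.map_apply] at h2
  rw [map_sub, h2, sub_self]

lemma det_laurentPolyMatrix_ne_zero (h : PosDefAEOnCircle (laurentMatrix N C)) :
    (laurentPolyMatrix N C).det ≠ 0 := by
  intro h0
  obtain ⟨z, hz, hpos⟩ := h.exists_posDef
  have h1 := congrArg (ev (Units.mk0 z hz)) h0
  rw [RingHom.map_det, RingHom.mapMatrix_apply, map_ev_laurentPolyMatrix, map_zero] at h1
  exact hpos.det_pos.ne' h1

/-- Semidefiniteness becomes definiteness off the finitely many zeros of the determinant. -/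
lemma posOnCircle_laurentPolyMatrix (h : PosDefAEOnCircle (laurentMatrix N C)) :
    PosOnCircle (laurentPolyMatrix N C) := by
  filter_upwards [(finite_setOf_ev_eq_zero (det_laurentPolyMatrix_ne_zero h)).compl_mem_cofinite,
    (Set.finite_singleton (1 : ℂˣ)).compl_mem_cofinite] with u hu hu1 hnu
  rw [map_ev_laurentPolyMatrix]
  refine (posSemidef_laurentMatrix h hnu hu1).posDef_iff_det_ne_zero.mpr ?_
  rwa [← map_ev_laurentPolyMatrix, ← RingHom.mapMatrix_apply, ← RingHom.map_det]

lemma scalarAdjoint_eval (p : ℂ[X]) (u : ℂˣ) :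
    scalarAdjoint (fun w => p.eval w) u = ev u (star (toLaurent p)) := by
  rw [ev_star, ev_toLaurent]
  simp [scalarAdjoint]

lemma det_laurentPolyMatrix {p : ℂ[X]} (hp : ∀ z : ℂ, z ≠ 0 →
    p.eval z * scalarAdjoint (fun w => p.eval w) z = (laurentMatrix N C z).det) :
    (laurentPolyMatrix N C).det = toLaurent p * star (toLaurent p) := by
  rw [← sub_eq_zero]
  refine laurent_eq_zero_of_infinite Set.infinite_univ fun u _ => ?_
  rw [map_sub, RingHom.map_det, RingHom.mapMatrix_apply, map_ev_laurentPolyMatrix, map_mul,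
    ev_toLaurent, ← scalarAdjoint_eval, hp u u.ne_zero, sub_self]

lemma polyMatrix_coeff {P : Matrix (Fin m) (Fin m) ℂ[X]} (hP : ∀ i j, (P i j).natDegree ≤ N)
    (z : ℂ) : polyMatrix N (fun k => P.map fun p => p.coeff k) z = P.map (Polynomial.eval z) := by
  refine Matrix.ext fun i j => ?_
  rw [Matrix.map_apply, eval_eq_sum_range' (Nat.lt_succ_of_le (hP i j))]
  simp [polyMatrix, Matrix.sum_apply, mul_comm]

lemma map_ev_conjTranspose_toLaurent (P : Matrix (Fin m) (Fin m) ℂ[X]) (u : ℂˣ) :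
    (P.map toLaurent)ᴴ.map (ev u) = matrixAdjoint (fun z => P.map (Polynomial.eval z)) u := by
  refine Matrix.ext fun i j => ?_
  rw [Matrix.map_apply, conjTranspose_apply, Matrix.map_apply, ev_star, ev_toLaurent]
  simp [matrixAdjoint]

end SpectralFactorization

theorem theorem2 (m N : ℕ) (C : ℤ → Matrix (Fin m) (Fin m) ℂ)
    (hdeg : C (N : ℤ) ≠ 0)
    (hpos : SpectralFactorization.PosDefAEOnCircle (SpectralFactorization.laurentMatrix N C))
    (p : Polynomial ℂ) (hpdeg : p.natDegree ≤ m * N)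
    (hp : ∀ z : ℂ, z ≠ 0 →
      p.eval z * SpectralFactorization.scalarAdjoint (fun w => p.eval w) z =
        (SpectralFactorization.laurentMatrix N C z).det) :
    ∃ B : ℕ → Matrix (Fin m) (Fin m) ℂ,
      B N ≠ 0 ∧
      (∀ z : ℂ, z ≠ 0 →
        SpectralFactorization.polyMatrix N B z *
            SpectralFactorization.matrixAdjoint (SpectralFactorization.polyMatrix N B) z =
          SpectralFactorization.laurentMatrix N C z) ∧
      (∀ z : ℂ, (SpectralFactorization.polyMatrix N B z).det = p.eval z) := by
  open SpectralFactorization in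
  have hm : Nonempty (Fin m) := by
    by_contra h
    rw [not_nonempty_iff] at h
    exact hdeg (Subsingleton.elim _ _)
  have hdet := det_laurentPolyMatrix hp
  have hp0 : p ≠ 0 := by
    rintro rfl
    exact det_laurentPolyMatrix_ne_zero hpos (by rw [hdet, map_zero, zero_mul])
  obtain ⟨P, hPN, hPS, hPdet⟩ := exists_factor_natDegree_le (isHermitian_laurentPolyMatrix hpos)
    (posOnCircle_laurentPolyMatrix hpos) laurentPolyMatrix_mul_T hp0
    (by rwa [Fintype.card_fin]) hdet
  have hfun : polyMatrix N (fun k => P.map fun p => p.coeff k) =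
      fun z => P.map (Polynomial.eval z) := funext fun z => polyMatrix_coeff hPN z
  refine ⟨fun k => P.map fun p => p.coeff k, ?_, ?_, ?_⟩
  · intro hB
    refine hdeg (Matrix.ext fun i j => ?_)
    rw [← coeff_laurentPolyMatrix (N := N) (C := C), ← hPS, Matrix.mul_apply,
      AddMonoidAlgebra.coeff_sum, Finsupp.finsetSum_apply]
    exact Finset.sum_eq_zero fun l _ =>
      coeff_mul_star_eq_zero (hPN i l) (congrFun (congrFun hB i) l)
  · intro z hz
    rw [hfun]
    have h1 := congrArg (fun M => M.map (ev (Units.mk0 z hz))) hPS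
    simp only [Matrix.map_mul, map_ev_conjTranspose_toLaurent, map_ev_laurentPolyMatrix,
      Units.val_mk0] at h1
    rw [← h1]
    congr 1
    refine Matrix.ext fun i j => ?_
    simp
  · intro z
    rw [hfun, ← hPdet]
    exact (RingHom.map_det (Polynomial.evalRingHom z) P).symm
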